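/- For an integer $r\ge 2$ let $f_r$ be the Takagi–Van der Waerden function $$f_r(x)=\sum_{n=0}^{\infty}\frac{1}{r^n}\,\phi(r^n x),$$ where $\phi(t)$ denotes the distance from the real number $t$ to the nearest integer. For $x\in[0,1]$ write $f_r'(x)=+\infty$ if $$\lim_{h\to 0,\ h\neq 0}\frac{f_r(x+h)-f_r(x)}{h}=+\infty ,$$ where for $x\in\{0,1\}$ the values of $f_r$ outside $[0,1]$ are given by the same formula (the $1$-periodic extension). Then, for every integer $r\ge 2$, the set $$\{x\in[0,1] : f_r'(x)=+\infty\}$$ has Lebesgue measure zero and Hausdorff dimension equal to $1$. -/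

import Mathlib

/-- The distance from the real number `x` to the nearest integer. -/
noncomputable def distNearestInt (x : ℝ) : ℝ := |x - (round x : ℝ)|

/-- The Takagi-Van der Waerden function `f_r(x) = ∑_{n ≥ 0} r⁻ⁿ φ(rⁿ x)`, where `φ` is the distance
to the nearest integer. The formula makes sense for every real `x` and gives the 1-periodic
extension of the function on `[0,1]`. -/
noncomputable def takagiVdW (r : ℕ) (x : ℝ) : ℝ :=
  ∑' n : ℕ, 1 / (r : ℝ) ^ n * distNearestInt ((r : ℝ) ^ n * x)

/-- The series that defines the Takagi-Van der Waerden function converges when `r ≥ 2`. -/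
theorem summable_takagiVdW (r : ℕ) (hr : 2 ≤ r) (x : ℝ) :
    Summable fun n : ℕ => 1 / (r : ℝ) ^ n * distNearestInt ((r : ℝ) ^ n * x) := by
  have h1 : (1 : ℝ) < r := by exact_mod_cast (by omega : 1 < r)
  have h0 : (0 : ℝ) < r := by linarith
  have hg : Summable fun n : ℕ => (1 / (r : ℝ)) ^ n :=
    summable_geometric_of_lt_one (by positivity) ((div_lt_one h0).2 h1)
  refine Summable.of_nonneg_of_le (fun n => ?_) (fun n => ?_) hg
  · unfold distNearestInt
    positivity
  · have h2 : distNearestInt ((r : ℝ) ^ n * x) ≤ 1 := by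
      have h3 := abs_sub_round ((r : ℝ) ^ n * x)
      unfold distNearestInt
      linarith
    rw [one_div_pow]
    exact mul_le_of_le_one_right (by positivity) h2

/-- `f` has the two-sided derivative `+∞` at `x`: the difference quotient `(f (x + h) - f x) / h`
tends to `+∞` as `h → 0`, `h ≠ 0`. -/
def HasDerivPosInfty (f : ℝ → ℝ) (x : ℝ) : Prop :=
  Filter.Tendsto (fun h : ℝ => (f (x + h) - f x) / h) (nhdsWithin 0 {0}ᶜ) Filter.atTop

/-!
The set has measure zero for a reason that has nothing to do with `f_r`: a function is monotone on
each of countably many sets that cover the points with derivative `+∞`, and monotone functions are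
almost everywhere differentiable (`HasDerivPosInfty.volume_setOf_eq_zero`).

For the dimension, note that the `n`-th summand of `f_r` is piecewise affine with slopes `1` and
`-1`, the slope at `x` being `(-1) ^ ⌊2 * r ^ n * x⌋`. If all the `2 * r ^ n * x` stay away from the
integers, the difference quotients of `f_r` at `x` agree up to a bounded error with the partial sums
of the slopes. It is then enough that these sums tend to `+∞` (`hasDerivPosInfty_takagiVdW`).

Such `x` are assembled from blocks of `m + 1` digits in base `r`, each the expansion of a number
`0 < w < r ^ m` followed by a digit `0`. The final `0` contributes a slope `1`, makes the other slopes
of the block depend on `w` alone, and ensures the distance from the integers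
(`digit_block_bounds`). The reflection `w ↦ r ^ m - 1 - w` essentially reverses the slopes, so at
least half of all `w` have a nonnegative sum of slopes (`exists_injective_slopeSum_nonneg`), and with
these the sum over every block is at least `1`. Already `r ^ n` blocks of length `n + 3` suffice for
dimension `n / (n + 3)`: reading the blocks as digits in base `r ^ n` maps the Cantor set of these `x`
onto `[0, 1]`, and this map is Hölder continuous with exponent `n / (n + 3)`
(`le_dimH_range_of_abs_sub_le`). Let `n` tend to infinity.
-/

/-! ### Infinite derivatives occur on a null set -/

/-- For an arbitrary function, the derivative is `+∞` only on a null set. The set is a countable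
union of sets on which `f` is monotone, and a monotone function on a set is almost everywhere
differentiable along that set. -/
theorem HasDerivPosInfty.volume_setOf_eq_zero (f : ℝ → ℝ) :
    MeasureTheory.volume {x | HasDerivPosInfty f x} = 0 := by
  -- Points of one `S n q` lie less than `1 / (n + 1)` apart, so `f` increases along `S n q`.
  set S : ℕ → ℤ → Set ℝ := fun n q => {x | HasDerivPosInfty f x ∧
    (∀ h : ℝ, h ≠ 0 → |h| < 1 / ((n : ℝ) + 1) → 1 ≤ (f (x + h) - f x) / h) ∧
      q / ((n : ℝ) + 1) ≤ x ∧ x < (q + 1) / ((n : ℝ) + 1)} with hS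
  have hcover : {x | HasDerivPosInfty f x} ⊆ ⋃ n, ⋃ q, S n q := by
    intro x hx
    have hev := hx.eventually_ge_atTop 1
    rw [eventually_nhdsWithin_iff, Metric.eventually_nhds_iff] at hev
    obtain ⟨ε, hε, hball⟩ := hev
    obtain ⟨n, hn⟩ := exists_nat_one_div_lt hε
    have hn1 : (0 : ℝ) < (n : ℝ) + 1 := by positivity
    refine Set.mem_iUnion.2 ⟨n, Set.mem_iUnion.2 ⟨⌊x * (n + 1)⌋, hx, fun h h0 hh => ?_, ?_, ?_⟩⟩
    · exact hball (by rw [Real.dist_eq, sub_zero]; exact hh.trans hn) h0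
    · rw [div_le_iff₀ hn1]; exact Int.floor_le _
    · rw [lt_div_iff₀ hn1]; exact Int.lt_floor_add_one _
  refine MeasureTheory.measure_mono_null hcover ?_
  refine MeasureTheory.measure_iUnion_null fun n => MeasureTheory.measure_iUnion_null fun q => ?_
  have hn1 : (0 : ℝ) < (n : ℝ) + 1 := by positivity
  have hmono : MonotoneOn f (S n q) := by
    intro x hx y hy hxy
    rcases hxy.eq_or_lt with rfl | hlt
    · exact le_rfl
    have hlen : y - x < 1 / ((n : ℝ) + 1) := by
      have h1 := hx.2.2.1
      have h2 := hy.2.2.2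
      rw [add_div] at h2
      linarith
    have hq := hx.2.1 (y - x) (by linarith) (by rwa [abs_of_pos (by linarith)])
    rw [le_div_iff₀ (by linarith), add_sub_cancel] at hq
    linarith
  have hae := hmono.locallyBoundedVariationOn.ae_differentiableWithinAt_of_mem
  have hiso := (countable_setOfPred_isolated_right_within (s := S n q)).ae_notMem
    MeasureTheory.volume
  rw [MeasureTheory.measure_eq_zero_iff_ae_notMem]
  filter_upwards [hae, hiso] with x hdiff hx hxS
  -- A derivative along `S n q` is finite, while the difference quotients through points of
  -- `S n q` to the right of `x` are unbounded.
  have hd := ((hdiff hxS).mono Set.inter_subset_left :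
    DifferentiableWithinAt ℝ f (S n q ∩ Set.Ioi x) x).hasDerivWithinAt
  rw [hasDerivWithinAt_iff_tendsto_slope' (by simp)] at hd
  have hne : (nhdsWithin x (S n q ∩ Set.Ioi x)).NeBot := ⟨fun h => hx ⟨hxS, h⟩⟩
  have hshift : Filter.Tendsto (fun y => y - x) (nhdsWithin x (S n q ∩ Set.Ioi x))
      (nhdsWithin 0 {0}ᶜ) := by
    refine tendsto_nhdsWithin_iff.2 ⟨?_, ?_⟩
    · have : Filter.Tendsto (fun y => y - x) (nhds x) (nhds (x - x)) :=
        (continuous_sub_right x).tendsto x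
      rw [sub_self] at this
      exact this.mono_left nhdsWithin_le_nhds
    · filter_upwards [self_mem_nhdsWithin] with y hy
      exact sub_ne_zero.2 (ne_of_gt hy.2)
  have hinf : Filter.Tendsto (slope f x) (nhdsWithin x (S n q ∩ Set.Ioi x)) Filter.atTop := by
    refine (hxS.1.comp hshift).congr fun y => ?_
    simp [slope_def_field]
  exact not_tendsto_nhds_of_tendsto_atTop hinf _ hd

/-! ### A criterion for the derivative to be `+∞` -/

theorem distNearestInt_nonneg (t : ℝ) : 0 ≤ distNearestInt t := abs_nonneg _

theorem distNearestInt_le_half (t : ℝ) : distNearestInt t ≤ 1 / 2 := abs_sub_round t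

theorem distNearestInt_eq_abs_sub_intCast {t : ℝ} (k : ℤ) (h : |t - k| ≤ 1 / 2) :
    distNearestInt t = |t - k| := by
  refine le_antisymm (round_le t k) ?_
  unfold distNearestInt
  by_cases hk : round t = k
  · rw [hk]
  have h1 : (1 : ℝ) ≤ |((round t - k : ℤ) : ℝ)| := by
    exact_mod_cast Int.one_le_abs (sub_ne_zero.2 hk)
  push_cast at h1
  have h2 : |(round t : ℝ) - k| ≤ |t - k| + |t - round t| := by
    rw [abs_sub_comm t (round t)]
    calc |(round t : ℝ) - k| = |(t - k) + ((round t : ℝ) - t)| := by congr 1; ring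
      _ ≤ _ := abs_add_le _ _
  linarith

/-- On `[p / 2, (p + 1) / 2]` the distance to the nearest integer is affine with slope `(-1) ^ p`. -/
theorem distNearestInt_add_sub {t u c : ℝ} {p : ℤ} (h1 : p + 2 * c ≤ 2 * t)
    (h2 : 2 * t ≤ p + 1 - 2 * c) (hu : |u| ≤ c) :
    distNearestInt (t + u) - distNearestInt t = ((-1 : ℤˣ) ^ p : ℤˣ) * u := by
  have hc : 0 ≤ c := (abs_nonneg u).trans hu
  obtain ⟨hu1, hu2⟩ := abs_le.1 hu
  rcases Int.even_or_odd p with hp | hp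
  · obtain ⟨k, hk⟩ := hp.two_dvd
    rw [hp.neg_one_zpow]
    subst hk
    push_cast at h1 h2
    have e1 : distNearestInt (t + u) = t + u - k := by
      rw [distNearestInt_eq_abs_sub_intCast k, abs_of_nonneg (by linarith)]
      rw [abs_le]; constructor <;> linarith
    have e2 : distNearestInt t = t - k := by
      rw [distNearestInt_eq_abs_sub_intCast k, abs_of_nonneg (by linarith)]
      rw [abs_le]; constructor <;> linarith
    rw [e1, e2]
    push_cast
    ring
  · obtain ⟨k, hk⟩ := id hp
    rw [hp.neg_one_zpow]
    subst hk
    push_cast at h1 h2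
    have e1 : distNearestInt (t + u) = k + 1 - (t + u) := by
      rw [distNearestInt_eq_abs_sub_intCast (k + 1), abs_of_nonpos (by push_cast; linarith)]
      · push_cast; ring
      · push_cast; rw [abs_le]; constructor <;> linarith
    have e2 : distNearestInt t = k + 1 - t := by
      rw [distNearestInt_eq_abs_sub_intCast (k + 1), abs_of_nonpos (by push_cast; linarith)]
      · push_cast; ring
      · push_cast; rw [abs_le]; constructor <;> linarith
    rw [e1, e2]
    push_cast
    ring

/-- Let all the points `2 * r ^ n * x` keep a distance `2 * c` from the integers, so that the
`n`-th summand has near `x` the slope `(-1) ^ p n`, where `p n` is the integer part. If these slopes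
sum to `+∞`, then the derivative at `x` is `+∞`: for `|h|` of size `c * r ^ (-N)`, the summands up to
`N` contribute their slopes exactly, and the later ones contribute a bounded amount. -/
theorem hasDerivPosInfty_takagiVdW {r : ℕ} (hr : 2 ≤ r) {x c : ℝ} (hc : 0 < c) (p : ℕ → ℤ)
    (h1 : ∀ n, p n + 2 * c ≤ 2 * ((r : ℝ) ^ n * x))
    (h2 : ∀ n, 2 * ((r : ℝ) ^ n * x) ≤ p n + 1 - 2 * c)
    (hs : Filter.Tendsto (fun N => ∑ n ∈ Finset.range N, (((-1 : ℤˣ) ^ p n : ℤˣ) : ℤ))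
      Filter.atTop Filter.atTop) :
    HasDerivPosInfty (takagiVdW r) x := by
  have hr2 : (2 : ℝ) ≤ r := by exact_mod_cast hr
  have hr0 : (0 : ℝ) < r := by linarith
  refine Filter.tendsto_atTop.2 fun A => ?_
  have hsR : Filter.Tendsto (fun N => ((∑ n ∈ Finset.range N, (((-1 : ℤˣ) ^ p n : ℤˣ) : ℤ) : ℤ) : ℝ))
      Filter.atTop Filter.atTop := tendsto_intCast_atTop_atTop.comp hs
  obtain ⟨N₀, hN₀⟩ := Filter.eventually_atTop.1 (hsR.eventually_ge_atTop (A + 1 / c))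
  rw [eventually_nhdsWithin_iff, Metric.eventually_nhds_iff]
  refine ⟨c * (1 / (r : ℝ)) ^ N₀, by positivity, fun h hh h0 => ?_⟩
  have h0' : h ≠ 0 := h0
  rw [Real.dist_eq, sub_zero] at hh
  have habs : 0 < |h| := abs_pos.2 h0'
  have hinv1 : 1 / (r : ℝ) < 1 := by rw [div_lt_one hr0]; linarith
  -- `N` is the last scale at which `x` and `x + h` lie on one linear piece of the summand.
  obtain ⟨N, hN1, hN2⟩ : ∃ N : ℕ, (1 / (r : ℝ)) ^ (N + 1) < |h| / c ∧
      |h| / c ≤ (1 / (r : ℝ)) ^ N := by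
    refine exists_nat_pow_near_of_lt_one (by positivity) ?_ (by positivity) hinv1
    rw [div_le_one hc]
    refine hh.le.trans (mul_le_of_le_one_right hc.le (pow_le_one₀ (by positivity) hinv1.le))
  have hNN : N₀ ≤ N + 1 := by
    by_contra hcon
    push Not at hcon
    have : (1 / (r : ℝ)) ^ N₀ ≤ (1 / (r : ℝ)) ^ (N + 1) :=
      pow_le_pow_of_le_one (by positivity) hinv1.le hcon.le
    rw [lt_div_iff₀ hc] at hN1
    nlinarith
  set T : ℕ → ℝ := fun n => (1 / (r : ℝ) ^ n * distNearestInt ((r : ℝ) ^ n * (x + h)) -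
    1 / (r : ℝ) ^ n * distNearestInt ((r : ℝ) ^ n * x)) / h with hT
  have hsum1 := summable_takagiVdW r hr (x + h)
  have hsum2 := summable_takagiVdW r hr x
  have hTsum : Summable T := (hsum1.sub hsum2).div_const h
  have hquot : (takagiVdW r (x + h) - takagiVdW r x) / h = ∑' n, T n := by
    rw [hT, tsum_div_const, hsum1.tsum_sub hsum2]
    rfl
  have hhead : ∀ n ∈ Finset.range (N + 1), T n = ((((-1 : ℤˣ) ^ p n : ℤˣ) : ℤ) : ℝ) := by
    intro n hn
    have hn' : n ≤ N := Nat.lt_succ_iff.1 (Finset.mem_range.1 hn)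
    have hu : |(r : ℝ) ^ n * h| ≤ c := by
      rw [abs_mul, abs_of_pos (by positivity : (0 : ℝ) < (r : ℝ) ^ n)]
      have : |h| / c ≤ (1 / (r : ℝ)) ^ n :=
        hN2.trans (pow_le_pow_of_le_one (by positivity) hinv1.le hn')
      rw [div_le_iff₀ hc, one_div_pow, one_div_mul_eq_div, le_div_iff₀ (by positivity)] at this
      linarith
    have := distNearestInt_add_sub (h1 n) (h2 n) hu
    have hrn : (r : ℝ) ^ n ≠ 0 := by positivity
    simp only [hT]
    rw [← mul_sub, mul_add, this]
    field_simp
  have htail : ∀ n, -(1 / (2 * c) * (1 / (r : ℝ)) ^ n) ≤ T (n + (N + 1)) := by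
    intro n
    have hφ : |distNearestInt ((r : ℝ) ^ (n + (N + 1)) * (x + h)) -
        distNearestInt ((r : ℝ) ^ (n + (N + 1)) * x)| ≤ 1 / 2 := by
      have a1 := distNearestInt_nonneg ((r : ℝ) ^ (n + (N + 1)) * (x + h))
      have a2 := distNearestInt_nonneg ((r : ℝ) ^ (n + (N + 1)) * x)
      have a3 := distNearestInt_le_half ((r : ℝ) ^ (n + (N + 1)) * (x + h))
      have a4 := distNearestInt_le_half ((r : ℝ) ^ (n + (N + 1)) * x)
      rw [abs_le]; constructor <;> linarith
    refine neg_le_of_abs_le ?_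
    simp only [hT]
    rw [← mul_sub, abs_div, abs_mul, abs_of_pos (by positivity), div_le_iff₀ habs, ← one_div_pow,
      pow_add]
    rw [lt_div_iff₀ hc] at hN1
    have hpos : 0 ≤ (1 / (r : ℝ)) ^ n := by positivity
    calc (1 / (r : ℝ)) ^ n * (1 / (r : ℝ)) ^ (N + 1) * _
        ≤ (1 / (r : ℝ)) ^ n * (1 / (r : ℝ)) ^ (N + 1) * (1 / 2) := by gcongr
      _ = 1 / (2 * c) * (1 / (r : ℝ)) ^ n * ((1 / (r : ℝ)) ^ (N + 1) * c) := by
          field_simp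
      _ ≤ _ := by gcongr
  have hgeo : Summable fun n : ℕ => (1 / (r : ℝ)) ^ n :=
    summable_geometric_of_lt_one (by positivity) hinv1
  have htail' : -(1 / c) ≤ ∑' n, T (n + (N + 1)) := by
    have hle := Summable.tsum_le_tsum htail (hgeo.mul_left _).neg
      ((summable_nat_add_iff (N + 1)).2 hTsum)
    rw [tsum_neg, tsum_mul_left, tsum_geometric_of_lt_one (by positivity) hinv1] at hle
    refine le_trans ?_ hle
    have hg : (1 - 1 / (r : ℝ))⁻¹ ≤ 2 := by
      rw [inv_le_comm₀ (by linarith) (by norm_num)]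
      have : 1 / (r : ℝ) ≤ 1 / 2 := one_div_le_one_div_of_le (by norm_num) hr2
      linarith
    rw [neg_le_neg_iff]
    calc 1 / (2 * c) * (1 - 1 / (r : ℝ))⁻¹ ≤ 1 / (2 * c) * 2 := by gcongr
      _ = 1 / c := by field_simp
  rw [hquot, ← hTsum.sum_add_tsum_nat_add (N + 1), Finset.sum_congr rfl hhead]
  have := hN₀ (N + 1) hNN
  push_cast at this ⊢
  linarith

/-! ### Digit blocks with a nonnegative sum of slopes -/

/-- The sum of the slopes of `distNearestInt` at the points `r ^ j * y`, `j < m`, where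
`y = (w + z) / r ^ m` with `0 < z < 1 / 2`, listed by `i = m - 1 - j`. Since `2 * z < 1`, the slopes
depend on the integer `w` only. -/
def slopeSum (r m w : ℕ) : ℤ := ∑ i ∈ Finset.range m, (-1) ^ (2 * w / r ^ (i + 1))

/-- The reflection `w ↦ Q - 1 - w` reverses a slope, except that both slopes may be `1`. -/
theorem neg_one_pow_div_add_reflect_nonneg {q Q w : ℕ} (hq : 0 < q) (hqQ : q ∣ Q) (hw : w < Q) :
    (0 : ℤ) ≤ (-1) ^ (2 * w / q) + (-1) ^ (2 * (Q - 1 - w) / q) := by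
  obtain ⟨k, rfl⟩ := hqQ
  obtain ⟨v, hv⟩ : ∃ v, v = q * k - 1 - w := ⟨_, rfl⟩
  rw [← hv]
  have hvw : v + w + 1 = q * k := by omega
  have hρ := Nat.mod_lt (2 * w) hq
  have hρ' := Nat.mod_lt (2 * v) hq
  have ha := Nat.div_add_mod (2 * w) q
  have ha' := Nat.div_add_mod (2 * v) q
  generalize 2 * w / q = a at *
  generalize 2 * v / q = b at *
  generalize 2 * w % q = ρ at *
  generalize 2 * v % q = ρ' at *
  have hsum : q * (a + b) + (ρ + ρ' + 2) = q * (2 * k) := by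
    rw [mul_add]; linarith
  have hdvd : q ∣ ρ + ρ' + 2 := (Nat.dvd_add_right (Dvd.intro _ rfl)).1 (hsum ▸ Dvd.intro _ rfl)
  obtain ⟨s, hs⟩ := hdvd
  have hab : a + b + s = 2 * k := by
    rw [hs, ← mul_add] at hsum
    exact Nat.eq_of_mul_eq_mul_left hq hsum
  have hs2 : s ≤ 2 := by
    by_contra hcon
    push Not at hcon
    have : q * 3 ≤ q * s := Nat.mul_le_mul_left q hcon
    omega
  have hs1 : s ≠ 0 := by
    rintro rfl
    omega
  obtain rfl | rfl : s = 1 ∨ s = 2 := by omega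
  · -- Neither remainder is extreme, and the two quotients have opposite parities.
    rcases Nat.even_or_odd a with h | h
    · have hb : Odd b := by
        rw [Nat.odd_iff]
        rw [Nat.even_iff] at h
        omega
      rw [h.neg_one_pow, hb.neg_one_pow]
      norm_num
    · have hb : Even b := by
        rw [Nat.even_iff]
        rw [Nat.odd_iff] at h
        omega
      rw [h.neg_one_pow, hb.neg_one_pow]
      norm_num
  · -- Both remainders equal `q - 1`, so `q * (a + 1) = 2 * w + 1` and both quotients are even.
    have hodd : Odd (q * (a + 1)) := ⟨w, by rw [mul_add]; omega⟩
    have ha2 : Even a := by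
      have := (Nat.odd_mul.1 hodd).2
      rw [Nat.odd_iff] at this
      rw [Nat.even_iff]
      omega
    have hb2 : Even b := by
      rw [Nat.even_iff] at ha2 ⊢
      omega
    rw [ha2.neg_one_pow, hb2.neg_one_pow]
    norm_num

theorem slopeSum_add_reflect_nonneg {r m w : ℕ} (hr : 0 < r) (hw : w < r ^ m) :
    0 ≤ slopeSum r m w + slopeSum r m (r ^ m - 1 - w) := by
  unfold slopeSum
  rw [← Finset.sum_add_distrib]
  refine Finset.sum_nonneg fun i hi => ?_
  exact neg_one_pow_div_add_reflect_nonneg (pow_pos hr _)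
    (pow_dvd_pow r (Finset.mem_range.1 hi)) hw

/-- By reflection at least half of the `w < r ^ (n + 2)` have a nonnegative sum of slopes; this
leaves `r ^ n` of them even after the exclusion of `w = 0`. -/
theorem exists_injective_slopeSum_nonneg {r : ℕ} (hr : 2 ≤ r) (n : ℕ) :
    ∃ e : Fin (r ^ n) → ℕ, Function.Injective e ∧
      ∀ i, 1 ≤ e i ∧ e i < r ^ (n + 2) ∧ 0 ≤ slopeSum r (n + 2) (e i) := by
  set Q := r ^ (n + 2) with hQ
  set G := (Finset.range Q).filter fun w => 0 ≤ slopeSum r (n + 2) w with hG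
  set N := (Finset.range Q).filter fun w => ¬ 0 ≤ slopeSum r (n + 2) w with hN
  have hcard : G.card + N.card = Q := by
    rw [hG, hN, Finset.card_filter_add_card_filter_not, Finset.card_range]
  have hle : N.card ≤ G.card := by
    refine Finset.card_le_card_of_injOn (fun w => Q - 1 - w) ?_ ?_
    · intro w hw
      rw [Finset.mem_coe, hN, Finset.mem_filter, Finset.mem_range] at hw
      have h1 := slopeSum_add_reflect_nonneg (by omega : 0 < r) hw.1
      rw [Finset.mem_coe, hG, Finset.mem_filter, Finset.mem_range]
      have h2 := hw.2
      have h3 := hw.1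
      simp only
      constructor
      · omega
      · linarith
    · intro v hv w hw h
      rw [Finset.mem_coe, hN, Finset.mem_filter, Finset.mem_range] at hv hw
      simp only at h
      omega
  have hpow : 1 ≤ r ^ n := Nat.one_le_pow _ _ (by omega)
  have hQ4 : 4 * r ^ n ≤ Q := by
    rw [hQ, pow_add, mul_comm]
    exact Nat.mul_le_mul_left _ (by nlinarith)
  have herase := Finset.pred_card_le_card_erase (s := G) (a := 0)
  obtain ⟨D, hDG, hD⟩ := Finset.exists_subset_card_eq (s := G.erase 0) (n := r ^ n) (by omega)
  refine ⟨fun i => D.orderEmbOfFin hD i, (D.orderEmbOfFin hD).injective, fun i => ?_⟩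
  have hmem := hDG (D.orderEmbOfFin_mem hD i)
  rw [Finset.mem_erase, hG, Finset.mem_filter, Finset.mem_range] at hmem
  exact ⟨Nat.one_le_iff_ne_zero.2 hmem.1, hmem.2.1, hmem.2.2⟩

/-! ### Expansions in a fixed base -/

theorem sum_range_tendsto_atTop_of_block {σ : ℕ → ℤ} {L : ℕ} (hL : 0 < L) (h1 : ∀ n, -1 ≤ σ n)
    (h2 : ∀ k, 1 ≤ ∑ j ∈ Finset.range L, σ (k * L + j)) :
    Filter.Tendsto (fun N => ∑ n ∈ Finset.range N, σ n) Filter.atTop Filter.atTop := by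
  have hblock : ∀ k : ℕ, (k : ℤ) ≤ ∑ n ∈ Finset.range (k * L), σ n := by
    intro k
    induction k with
    | zero => simp
    | succ k ih =>
      rw [Nat.succ_mul, Finset.sum_range_add]
      have := h2 k
      push_cast
      linarith
  have hall : ∀ k j : ℕ, (k : ℤ) - j ≤ ∑ n ∈ Finset.range (k * L + j), σ n := by
    intro k j
    induction j with
    | zero => simpa using hblock k
    | succ j ih =>
      rw [← add_assoc, Finset.sum_range_succ]
      have := h1 (k * L + j)
      push_cast
      linarith
  refine Filter.tendsto_atTop.2 fun A => ?_
  filter_upwards [Filter.eventually_ge_atTop ((A.toNat + L) * L)] with N hN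
  have h3 := hall (N / L) (N % L)
  rw [Nat.div_add_mod'] at h3
  have h4 : A.toNat + L ≤ N / L := (Nat.le_div_iff_mul_le hL).2 hN
  have h5 := Nat.mod_lt N hL
  have h6 := Int.self_le_toNat A
  omega

theorem ofDigits_eq_div {b : ℕ} (a : ℕ → Fin b) :
    Real.ofDigits a = ((a 0 : ℕ) + Real.ofDigits fun i => a (i + 1)) / b := by
  rw [Real.ofDigits_eq_sum_add_ofDigits a 1]
  simp only [Finset.range_one, Finset.sum_singleton, Real.ofDigitsTerm]
  ring

theorem exists_pow_mul_ofDigits_eq {b : ℕ} (a : ℕ → Fin b) (k : ℕ) :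
    ∃ I : ℕ, (b : ℝ) ^ k * Real.ofDigits a = I + Real.ofDigits fun i => a (i + k) := by
  have hb : (b : ℝ) ≠ 0 := by exact_mod_cast (Fin.pos (a 0)).ne'
  induction k with
  | zero => exact ⟨0, by simp⟩
  | succ k ih =>
    obtain ⟨I, hI⟩ := ih
    refine ⟨b * I + a k, ?_⟩
    rw [pow_succ', mul_assoc, hI, ofDigits_eq_div fun i => a (i + k)]
    simp only [zero_add]
    have : (fun i => a (i + 1 + k)) = fun i => a (i + (k + 1)) := by
      ext i; congr 2; ring
    rw [this]
    push_cast
    field_simp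
    ring

/-- If the points `G i` determine parameters `t i` that fill the unit interval, in a Hölder
continuous way with exponent `α`, then the points form a set of dimension at least `α`. -/
theorem le_dimH_range_of_abs_sub_le {ι : Type*} {C α : NNReal} (hα : 0 < α) (G t : ι → ℝ)
    (ht : Set.Icc 0 1 ⊆ Set.range t)
    (h : ∀ a b, |t a - t b| ≤ C * |G a - G b| ^ (α : ℝ)) :
    (α : ENNReal) ≤ dimH (Set.range G) := by
  obtain ⟨i₀, -⟩ := ht (Set.left_mem_Icc.2 zero_le_one)
  have : Nonempty ι := ⟨i₀⟩
  have hfac : ∀ i, t (Function.invFun G (G i)) = t i := by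
    intro i
    have h1 := h (Function.invFun G (G i)) i
    rw [Function.invFun_eq (f := G) (b := G i) ⟨i, rfl⟩, sub_self, abs_zero,
      Real.zero_rpow (by exact_mod_cast hα.ne'), mul_zero] at h1
    exact sub_eq_zero.1 (abs_nonpos_iff.1 h1)
  have hhol : HolderOnWith C α (fun x => t (Function.invFun G x)) (Set.range G) := by
    rintro _ ⟨a, rfl⟩ _ ⟨b, rfl⟩
    simp only [hfac]
    rw [edist_dist, edist_dist, ENNReal.ofReal_rpow_of_nonneg dist_nonneg α.coe_nonneg,
      ← ENNReal.ofReal_coe_nnreal, ← ENNReal.ofReal_mul C.coe_nonneg]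
    exact ENNReal.ofReal_le_ofReal (h a b)
  have himage : Set.Icc (0 : ℝ) 1 ⊆ (fun x => t (Function.invFun G x)) '' Set.range G := by
    intro y hy
    obtain ⟨i, rfl⟩ := ht hy
    exact ⟨G i, ⟨i, rfl⟩, hfac i⟩
  have hone : dimH (Set.Icc (0 : ℝ) 1) = 1 := by
    rw [← segment_eq_Icc zero_le_one]
    exact Real.dimH_segment zero_ne_one
  have hle := (dimH_mono himage).trans (hhol.dimH_image_le hα)
  rw [hone, ENNReal.le_div_iff_mul_le (by simp [hα.ne']) (by simp), one_mul] at hle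
  exact hle

/-! ### The Cantor sets of numbers with restricted digits -/

section Coding

-- The digit `d i = r * e i` in base `r ^ (m + 1)` is a block of `m + 1` digits in base `r` of which
-- the last is `0`.
variable {r m M : ℕ} {e : Fin M → ℕ} {d : Fin M → Fin (r ^ (m + 1))}

/-- The last digit `0` of a block keeps the numbers away from `1`, the condition `w ≠ 0` keeps them
away from `0`. -/
theorem ofDigits_mem_Icc (hr : 2 ≤ r) (hd : ∀ i, (d i : ℕ) = r * e i)
    (he : ∀ i, 1 ≤ e i ∧ e i < r ^ m) (a : ℕ → Fin M) :
    Real.ofDigits (fun k => d (a k)) ∈ Set.Icc (((r : ℝ) ^ m)⁻¹) (1 - ((r : ℝ) ^ m)⁻¹ / 2) := by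
  have hr2 : (2 : ℝ) ≤ r := by exact_mod_cast hr
  have h0 := Real.ofDigits_nonneg fun k => d (a (k + 1))
  have h1 := Real.ofDigits_le_one fun k => d (a (k + 1))
  have hrm : (0 : ℝ) < (r : ℝ) ^ m := by positivity
  have e1 : (1 : ℝ) ≤ e (a 0) := by exact_mod_cast (he (a 0)).1
  have e2 : (e (a 0) : ℝ) + 1 ≤ (r : ℝ) ^ m := by exact_mod_cast (he (a 0)).2
  rw [ofDigits_eq_div, hd]
  push_cast
  constructor
  · rw [le_div_iff₀ (by positivity), pow_succ, inv_mul_cancel_left₀ hrm.ne']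
    nlinarith
  · rw [div_le_iff₀ (by positivity), pow_succ (r : ℝ) m]
    have : (1 - ((r : ℝ) ^ m)⁻¹ / 2) * ((r : ℝ) ^ m * r) = (r : ℝ) ^ m * r - r / 2 := by
      field_simp
    rw [this]
    nlinarith

/-- Numbers with different first digits are separated, because the digits are multiples of `r`. -/
theorem inv_le_abs_ofDigits_sub (hr : 2 ≤ r) (hd : ∀ i, (d i : ℕ) = r * e i)
    (hinj : Function.Injective e) {a b : ℕ → Fin M} (hab : a 0 ≠ b 0) :
    ((r : ℝ) ^ (m + 1))⁻¹ ≤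
      |Real.ofDigits (fun k => d (a k)) - Real.ofDigits (fun k => d (b k))| := by
  wlog hlt : e (b 0) < e (a 0) generalizing a b
  · rw [abs_sub_comm]
    exact this hab.symm (lt_of_le_of_ne (not_lt.1 hlt) fun h => hab (hinj h))
  have hr2 : (2 : ℝ) ≤ r := by exact_mod_cast hr
  have h0 := Real.ofDigits_nonneg fun k => d (a (k + 1))
  have h1 := Real.ofDigits_le_one fun k => d (b (k + 1))
  have h2 : (e (b 0) : ℝ) + 1 ≤ e (a 0) := by exact_mod_cast hlt
  refine le_trans ?_ (le_abs_self _)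
  rw [ofDigits_eq_div, ofDigits_eq_div fun k => d (b k), hd, hd, ← sub_div, inv_eq_one_div]
  push_cast
  gcongr
  nlinarith

/-- Here `(r * w + y) / r ^ (m + 1) = (w + z) / r ^ m` with `z = y / r` well inside `(0, 1 / 2)`.
Multiplication by `2 * r ^ j` gives `(2 * w + 2 * z) / r ^ (m - j)`, whose integer part is that of
`2 * w / r ^ (m - j)` and whose fractional part avoids `0` and `1`. -/
theorem digit_block_bounds (hr : 2 ≤ r) {j w : ℕ} (hj : j ≤ m) {y : ℝ}
    (hy : y ∈ Set.Icc (((r : ℝ) ^ m)⁻¹) (1 - ((r : ℝ) ^ m)⁻¹ / 2)) :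
    ((2 * w / r ^ (m - j) : ℕ) : ℝ) + 2 * (((r : ℝ) ^ (2 * m + 1))⁻¹ / 4) ≤
        2 * ((r : ℝ) ^ j * (((r * w : ℕ) + y) / (r ^ (m + 1) : ℕ))) ∧
      2 * ((r : ℝ) ^ j * (((r * w : ℕ) + y) / (r ^ (m + 1) : ℕ))) ≤
        ((2 * w / r ^ (m - j) : ℕ) : ℝ) + 1 - 2 * (((r : ℝ) ^ (2 * m + 1))⁻¹ / 4) := by
  have hr2 : (2 : ℝ) ≤ r := by exact_mod_cast hr
  have hr0 : (0 : ℝ) < r := by linarith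
  obtain ⟨i, rfl⟩ := Nat.exists_eq_add_of_le hj
  rw [Nat.add_sub_cancel_left]
  obtain ⟨hy1, hy2⟩ := hy
  set m := j + i with hm
  have hq : 0 < r ^ i := by positivity
  have hdm := Nat.div_add_mod (2 * w) (r ^ i)
  have hlt := Nat.mod_lt (2 * w) hq
  set A := 2 * w / r ^ i
  set ρ := 2 * w % r ^ i
  have hdmR : (r : ℝ) ^ i * A + ρ = 2 * w := by exact_mod_cast hdm
  have hltR : (ρ : ℝ) + 1 ≤ (r : ℝ) ^ i := by exact_mod_cast hlt
  have hqR : (0 : ℝ) < (r : ℝ) ^ i := by positivity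
  have heq : 2 * ((r : ℝ) ^ j * (((r * w : ℕ) + y) / (r ^ (m + 1) : ℕ))) =
      A + (ρ + 2 * (y / r)) / (r : ℝ) ^ i := by
    have : 2 * ((r : ℝ) ^ j * (((r * w : ℕ) + y) / (r ^ (m + 1) : ℕ))) =
        (2 * w + 2 * (y / r)) / (r : ℝ) ^ i := by
      rw [hm]
      push_cast
      rw [pow_succ, pow_add]
      field_simp
    rw [this, ← hdmR]
    field_simp
    ring
  rw [heq]
  have hε : ((r : ℝ) ^ (2 * m + 1))⁻¹ = ((r : ℝ) ^ m)⁻¹ / r / (r : ℝ) ^ m := by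
    rw [pow_succ, two_mul, pow_add]
    field_simp
  have him : (r : ℝ) ^ i ≤ (r : ℝ) ^ m := pow_le_pow_right₀ (by linarith) (by omega)
  set ε := ((r : ℝ) ^ m)⁻¹ with hεdef
  have hε0 : 0 < ε := by positivity
  have hle : ((r : ℝ) ^ (2 * m + 1))⁻¹ ≤ ε / r / (r : ℝ) ^ i := by
    rw [hε]; gcongr
  have hyr : ε / r ≤ y / r := by gcongr
  have hyr' : 2 * (y / r) ≤ 1 - ε / r / 2 := by
    have h1 : y / r ≤ (1 - ε / 2) / r := by gcongr
    have h2 : (1 - ε / 2) / r = 1 / r - ε / r / 2 := by ring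
    have h3 : 1 / (r : ℝ) ≤ 1 / 2 := one_div_le_one_div_of_le (by norm_num) hr2
    have h4 : 0 < ε / r := by positivity
    linarith
  have hρ0 : (0 : ℝ) ≤ ρ := by positivity
  have h5 : 0 < ε / r := by positivity
  constructor
  · have : ε / r / (r : ℝ) ^ i ≤ (ρ + 2 * (y / r)) / (r : ℝ) ^ i := by
      gcongr
      linarith
    have : 0 < ε / r / (r : ℝ) ^ i := by positivity
    linarith
  · have : (ρ + 2 * (y / r)) / (r : ℝ) ^ i ≤ ((r : ℝ) ^ i - ε / r / 2) / (r : ℝ) ^ i := by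
      gcongr
      linarith
    have h6 : ((r : ℝ) ^ i - ε / r / 2) / (r : ℝ) ^ i = 1 - ε / r / (r : ℝ) ^ i / 2 := by
      field_simp
    linarith

/-- Each block of `m + 1` slopes has sum at least `1`: the last one, at the digit `0`, is `1`, and
the others have a nonnegative sum. -/
theorem hasDerivPosInfty_ofDigits (hr : 2 ≤ r) (hd : ∀ i, (d i : ℕ) = r * e i)
    (he : ∀ i, 1 ≤ e i ∧ e i < r ^ m) (hs : ∀ i, 0 ≤ slopeSum r m (e i)) (a : ℕ → Fin M) :
    HasDerivPosInfty (takagiVdW r) (Real.ofDigits fun k => d (a k)) := by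
  set x := Real.ofDigits fun k => d (a k) with hx
  set c : ℝ := ((r : ℝ) ^ (2 * m + 1))⁻¹ / 4 with hc
  have hr0 : (0 : ℝ) < r := by exact_mod_cast (by omega : 0 < r)
  have hkey : ∀ n : ℕ, ∃ p : ℤ, p + 2 * c ≤ 2 * ((r : ℝ) ^ n * x) ∧
      2 * ((r : ℝ) ^ n * x) ≤ p + 1 - 2 * c ∧
      (((-1 : ℤˣ) ^ p : ℤˣ) : ℤ) =
        (-1) ^ (2 * e (a (n / (m + 1))) / r ^ (m - n % (m + 1))) := by
    intro n
    set k := n / (m + 1)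
    set j := n % (m + 1)
    have hj : j ≤ m := Nat.lt_succ_iff.1 (Nat.mod_lt n (Nat.succ_pos m))
    obtain ⟨I, hI⟩ := exists_pow_mul_ofDigits_eq (fun k => d (a k)) k
    have hb := digit_block_bounds hr (w := e (a k)) hj
      (ofDigits_mem_Icc hr hd he fun i => a (i + 1 + k))
    have hsplit : (r : ℝ) ^ n * x = r ^ j * I + (r : ℝ) ^ j *
        (((r * e (a k) : ℕ) + Real.ofDigits fun i => d (a (i + 1 + k))) /
          (r ^ (m + 1) : ℕ)) := by
      rw [← hx, ofDigits_eq_div fun i => d (a (i + k)), zero_add, hd] at hI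
      rw [← mul_add, ← hI]
      have hn : n = j + (m + 1) * k := (Nat.mod_add_div n (m + 1)).symm
      nth_rewrite 1 [hn]
      rw [pow_add, pow_mul]
      push_cast
      ring
    rw [← hc] at hb
    generalize 2 * e (a k) / r ^ (m - j) = A at hb ⊢
    refine ⟨2 * (r ^ j * I : ℕ) + (A : ℕ), ?_, ?_, ?_⟩
    · rw [hsplit]
      have := hb.1
      push_cast at this ⊢
      linarith
    · rw [hsplit]
      have := hb.2
      push_cast at this ⊢
      linarith
    · rw [zpow_add, zpow_mul, zpow_natCast]
      simp
  choose p hp1 hp2 hp3 using hkey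
  refine hasDerivPosInfty_takagiVdW hr (by positivity : 0 < c) p hp1 hp2 ?_
  simp only [hp3]
  refine sum_range_tendsto_atTop_of_block (Nat.succ_pos m) (fun n => ?_) fun k => ?_
  · rcases neg_one_pow_eq_or ℤ (2 * e (a (n / (m + 1))) / r ^ (m - n % (m + 1))) with h | h
    · norm_num [h]
    · exact h.ge
  · have hterm : ∀ j ∈ Finset.range (m + 1),
        (-1 : ℤ) ^ (2 * e (a ((k * (m + 1) + j) / (m + 1))) /
          r ^ (m - (k * (m + 1) + j) % (m + 1))) = (-1) ^ (2 * e (a k) / r ^ (m + 1 - 1 - j)) := by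
      intro j hj
      have hj' : j < m + 1 := Finset.mem_range.1 hj
      rw [mul_comm k, Nat.mul_add_mod, Nat.mod_eq_of_lt hj', Nat.mul_add_div (Nat.succ_pos m),
        Nat.div_eq_of_lt hj', add_zero, Nat.add_sub_cancel]
    rw [Finset.sum_congr rfl hterm,
      Finset.sum_range_reflect (fun i => (-1 : ℤ) ^ (2 * e (a k) / r ^ i)) (m + 1),
      Finset.sum_range_succ']
    have := hs (a k)
    unfold slopeSum at this
    simpa using this

end Coding

/-- A Cantor set with `r ^ n` digits in base `r ^ (n + 3)` has dimension at least `n / (n + 3)`. -/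
theorem le_dimH_setOf_hasDerivPosInfty {r : ℕ} (hr : 2 ≤ r) {n : ℕ} (hn : 0 < n) :
    (((n : NNReal) / (n + 3) : NNReal) : ENNReal) ≤
      dimH {x : ℝ | x ∈ Set.Icc (0 : ℝ) 1 ∧ HasDerivPosInfty (takagiVdW r) x} := by
  obtain ⟨e, hinj, he⟩ := exists_injective_slopeSum_nonneg hr n
  have hr2 : (2 : ℝ) ≤ r := by exact_mod_cast hr
  have hr0 : (0 : ℝ) < r := by linarith
  set d : Fin (r ^ n) → Fin (r ^ (n + 2 + 1)) := fun i =>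
    ⟨r * e i, by rw [pow_succ']; exact Nat.mul_lt_mul_of_pos_left (he i).2.1 (by omega)⟩
  have hd : ∀ i, (d i : ℕ) = r * e i := fun _ => rfl
  have hsub : Set.range (fun a : ℕ → Fin (r ^ n) => Real.ofDigits fun k => d (a k)) ⊆
      {x : ℝ | x ∈ Set.Icc (0 : ℝ) 1 ∧ HasDerivPosInfty (takagiVdW r) x} := by
    rintro _ ⟨a, rfl⟩
    exact ⟨⟨Real.ofDigits_nonneg _, Real.ofDigits_le_one _⟩,
      hasDerivPosInfty_ofDigits hr hd (fun i => ⟨(he i).1, (he i).2.1⟩) (fun i => (he i).2.2) a⟩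
  refine le_trans ?_ (dimH_mono hsub)
  refine le_dimH_range_of_abs_sub_le (C := (r : NNReal) ^ n) (by positivity) _ Real.ofDigits ?_ ?_
  · intro y hy
    obtain ⟨a, -, ha⟩ := Real.ofDigits_SurjOn (Nat.one_lt_pow hn.ne' (by omega : 1 < r)) hy
    exact ⟨a, ha⟩
  intro a b
  by_cases hab : a = b
  · subst hab
    simp only [sub_self, abs_zero]
    positivity
  have hex : ∃ k, a k ≠ b k := Function.ne_iff.1 hab
  -- The two numbers lie in one interval of length `r ^ (-(n + 3) * k)`, but not in one of the next
  -- generation.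
  set k := Nat.find hex with hk
  have hagree : ∀ i < k, a i = b i := fun i hi => not_not.1 (Nat.find_min hex hi)
  have h1 := Real.abs_ofDigits_sub_ofDigits_le hagree
  have h2 := inv_le_abs_ofDigits_sub hr hd hinj (a := fun i => a (i + k)) (b := fun i => b (i + k))
    (by simpa using Nat.find_spec hex)
  have h3 : |Real.ofDigits (fun i => d (a i)) - Real.ofDigits (fun i => d (b i))| =
      (((r ^ (n + 2 + 1) : ℕ) : ℝ) ^ k)⁻¹ *
        |Real.ofDigits (fun i => d (a (i + k))) - Real.ofDigits (fun i => d (b (i + k)))| := by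
    rw [Real.ofDigits_eq_sum_add_ofDigits (fun i => d (a i)) k,
      Real.ofDigits_eq_sum_add_ofDigits (fun i => d (b i)) k]
    have : ∑ i ∈ Finset.range k, Real.ofDigitsTerm (fun i => d (a i)) i =
        ∑ i ∈ Finset.range k, Real.ofDigitsTerm (fun i => d (b i)) i :=
      Finset.sum_congr rfl fun i hi => by
        simp only [Real.ofDigitsTerm, hagree i (Finset.mem_range.1 hi)]
    rw [this, add_sub_add_left_eq_sub, ← mul_sub, abs_mul, abs_of_nonneg (by positivity)]
  have h4 : ((r : ℝ) ^ ((n + 3) * (k + 1)))⁻¹ ≤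
      |Real.ofDigits (fun i => d (a i)) - Real.ofDigits (fun i => d (b i))| := by
    rw [h3]
    calc ((r : ℝ) ^ ((n + 3) * (k + 1)))⁻¹
        = (((r ^ (n + 2 + 1) : ℕ) : ℝ) ^ k)⁻¹ * ((r : ℝ) ^ (n + 2 + 1))⁻¹ := by
          rw [← mul_inv, pow_mul, pow_succ]; push_cast; rfl
      _ ≤ _ := by gcongr
  have h5 : (((r : ℝ) ^ ((n + 3) * (k + 1)))⁻¹) ^ ((n : ℝ) / (n + 3)) =
      ((r : ℝ) ^ (n * (k + 1)))⁻¹ := by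
    rw [Real.inv_rpow (by positivity), ← Real.rpow_natCast, ← Real.rpow_natCast,
      ← Real.rpow_mul hr0.le]
    congr 2
    push_cast
    field_simp
  calc |Real.ofDigits a - Real.ofDigits b| ≤ (((r ^ n : ℕ) : ℝ) ^ k)⁻¹ := h1
    _ = (r : ℝ) ^ n * (((r : ℝ) ^ ((n + 3) * (k + 1)))⁻¹) ^ ((n : ℝ) / (n + 3)) := by
        rw [h5, mul_add, pow_add, mul_one, pow_mul]
        push_cast
        field_simp
    _ ≤ _ := by
        push_cast
        gcongr

/-! ### Measure and dimension of the set of infinite derivative -/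

theorem mainTheorem3 (r : ℕ) (hr : 2 ≤ r) :
    MeasureTheory.volume {x : ℝ | x ∈ Set.Icc (0 : ℝ) 1 ∧ HasDerivPosInfty (takagiVdW r) x} = 0 ∧
    dimH {x : ℝ | x ∈ Set.Icc (0 : ℝ) 1 ∧ HasDerivPosInfty (takagiVdW r) x} = 1 := by
  refine ⟨MeasureTheory.measure_mono_null (fun x hx => hx.2)
    (HasDerivPosInfty.volume_setOf_eq_zero (takagiVdW r)), le_antisymm ?_ ?_⟩
  · exact (dimH_mono (Set.subset_univ _)).trans_eq Real.dimH_univ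
  · have hlim : Filter.Tendsto (fun n : ℕ => (((n : NNReal) / (n + 3) : NNReal) : ENNReal))
        Filter.atTop (nhds 1) := by
      rw [← ENNReal.coe_one, ENNReal.tendsto_coe, ← NNReal.tendsto_coe]
      simpa using tendsto_natCast_div_add_atTop (3 : ℝ)
    refine le_of_tendsto hlim ?_
    filter_upwards [Filter.eventually_gt_atTop 0] with n hn
    exact le_dimH_setOf_hasDerivPosInfty hr hn
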